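/- Let $\mathcal S$ be a finite or countable set, let $p=(p_{xy})_{x,y\in\mathcal S}$ be an irreducible and recurrent transition matrix, and let $m=(m_x)_{x\in\mathcal S}$ be a stationary measure of $p$ with weights $0<m_x<\infty$ (its total mass may be infinite). For a probability measure $\mu$ on $\mathcal S$, a process $(X_n)_{n\in\mathbb Z}$ is called the two-sided Markov chain with transition matrix $p$ and initial distribution $\mu$ if $X_0$ has law $\mu$ and, conditionally on $X_0$, the processes $(X_n)_{n\ge 0}$ and $(X_{-n})_{n\ge 0}$ are independent Markov chains with transition probabilities $p_{xy}$ and $p^*_{xy}=\frac{m_y}{m_x}\,p_{yx}$, respectively; that is, for all $a,b\in\mathbb N_0$ and all states $x_{-a},\dots,x_b$, $$\mathbb P(X_k=x_k \text{ for } -a\le k\le b)=\mu_{x_0}\prod_{k=0}^{b-1}p_{x_kx_{k+1}}\prod_{k=0}^{a-1}p^*_{x_{-k}x_{-k-1}} .$$ Let $X=(X_n)_{n\in\mathbb Z}$ be the two-sided Markov chain with transition matrix $p$ and initial state $X_0=i$, where $i\in\mathcal S$ (initial distribution $\delta_i$), and let $\nu=(\nu_j)_{j\in\mathcal S}$ be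 any probability measure on $\mathcal S$. A random time $T$ (with values in $\mathbb Z\cup\{\infty\}$, almost surely finite) is called non-randomized if it is a measurable function of the trajectory $(X_n)_{n\in\mathbb Z}$. Then the following statements are equivalent. (a) There exists a non-randomized random time $T$ such that $(X_{n+T})_{n\in\mathbb Z}$ is a two-sided Markov chain with transition matrix $p$ and $X_T$ has law $\nu$, i.e. $(X_{n+T})_{n\in\mathbb Z}$ is the two-sided Markov chain with transition matrix $p$ and initial distribution $\nu$. (b) $\frac{m_i}{m_j}\,\nu_j\in\mathbb Z$ for all $j\in\mathcal S$. Moreover, if a random time $T$ as in (a) exists, it can be taken to be a non-negative stopping time, that is, $T\ge 0$ and $\{T\le n\}\in\sigma(X_0,\dots,X_n)$ for all $n\ge 0$. -/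

import Mathlib

open MeasureTheory ProbabilityTheory
open scoped ENNReal NNReal

noncomputable section

namespace TwoSided

variable {S : Type*}

/-- Row `x` of the `n`-step transition matrix `p ^ n`; the row `x` of the transition matrix is the
probability mass function `p x`. -/
def stepDist (p : S → PMF S) : ℕ → S → PMF S
  | 0, x => PMF.pure x
  | n + 1, x => (p x).bind (stepDist p n)

/-- Every state can be reached from every state. -/
def IsIrreducible (p : S → PMF S) : Prop :=
  ∀ x y : S, ∃ n : ℕ, 0 < stepDist p n x y

/-- `firstHitProb p y n x` is the probability that the chain started in `x` visits `y` at time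
`n + 1` and at none of the times `1, …, n`. -/
def firstHitProb (p : S → PMF S) (y : S) : ℕ → S → ℝ≥0∞
  | 0, x => p x y
  | n + 1, x => ∑' z : {z : S // z ≠ y}, p x z * firstHitProb p y n z

/-- From every state the chain returns to that state at some positive time with probability one. -/
def IsRecurrent (p : S → PMF S) : Prop :=
  ∀ x : S, ∑' n : ℕ, firstHitProb p x n x = 1

/-- `m` is a stationary measure with positive (finite) weights; its total mass may be infinite. -/
def IsStationary (p : S → PMF S) (m : S → ℝ≥0) : Prop :=
  (∀ x, 0 < m x) ∧ ∀ y, ∑' x, (m x : ℝ≥0∞) * p x y = m y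

/-- The dual transition probabilities `(m y / m x) * p y x`. -/
def dual (p : S → PMF S) (m : S → ℝ≥0) (x y : S) : ℝ≥0∞ :=
  (m y : ℝ≥0∞) / m x * p y x

/-- `X` is, under `P`, the two-sided Markov chain with transition matrix `p` and initial
distribution `μ`: the state `X 0` has law `μ` and, given `X 0`, the forward chain `(X n)_{n ≥ 0}`
and the backward chain `(X (-n))_{n ≥ 0}` are independent Markov chains with transition matrix `p`
and the dual transition matrix, respectively. This is expressed by the probabilities of all finite
blocks `X (-a) = x (-a), …, X b = x b`. -/
structure IsTwoSidedChain {Ω : Type*} [MeasurableSpace Ω] [MeasurableSpace S]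
    (p : S → PMF S) (m : S → ℝ≥0) (μ : PMF S) (P : Measure Ω) (X : ℤ → Ω → S) : Prop where
  measurable : ∀ n, Measurable (X n)
  prob_block : ∀ (a b : ℕ) (x : ℤ → S),
    P {ω | ∀ k : ℤ, -(a : ℤ) ≤ k → k ≤ (b : ℤ) → X k ω = x k} =
      μ (x 0) * (∏ k ∈ Finset.range b, p (x (k : ℤ)) (x ((k : ℤ) + 1)))
        * ∏ k ∈ Finset.range a, dual p m (x (-(k : ℤ))) (x (-(k : ℤ) - 1))

/-- The shifted process `(X (n + T))_{n ∈ ℤ}`; the value used where `T = ⊤` is irrelevant, as this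
is only used for almost surely finite `T`. -/
def shifted {Ω : Type*} (X : ℤ → Ω → S) (T : Ω → WithTop ℤ) : ℤ → Ω → S :=
  fun n ω => X (n + (T ω).untopD 0) ω

/-- `T` is a measurable function of the trajectory of `X`. -/
def NonRandomized {Ω : Type*} [MeasurableSpace S] (X : ℤ → Ω → S) (T : Ω → WithTop ℤ) : Prop :=
  ∃ τ : (ℤ → S) → WithTop ℤ, Measurable τ ∧ ∀ ω, T ω = τ (fun n => X n ω)

/-- `T` is an almost surely finite random time such that `(X (n + T))_{n ∈ ℤ}` is a two-sided Markov
chain with transition matrix `p` and `X T` has law `ν`. -/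
def IsEmbedding {Ω : Type*} [MeasurableSpace Ω] [MeasurableSpace S]
    (p : S → PMF S) (m : S → ℝ≥0) (ν : PMF S) (P : Measure Ω) (X : ℤ → Ω → S)
    (T : Ω → WithTop ℤ) : Prop :=
  (∀ᵐ ω ∂P, T ω ≠ ⊤) ∧ IsTwoSidedChain p m ν P (shifted X T)

/-- The filtration whose `n`-th σ-algebra is generated by `X 0, …, X n` (trivial for `n < 0`). A
stopping time for it is one for the filtration generated by all `X k` with `k ≤ n` as well. -/
def forwardFiltration {Ω : Type*} [mΩ : MeasurableSpace Ω] [mS : MeasurableSpace S]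
    (X : ℤ → Ω → S) (hX : ∀ n, Measurable (X n)) : Filtration ℤ mΩ where
  seq n := ⨆ k ∈ Set.Icc (0 : ℤ) n, mS.comap (X k)
  mono' _ _ h := biSup_mono fun _ hk => ⟨hk.1, hk.2.trans h⟩
  le' _ := iSup₂_le fun k _ => (hX k).comap_le

end TwoSided

end

/-
Let `Q` be the shift-invariant law of the chain with initial measure `m`. A random time `τ`, applied
to the path as seen from each of its visits to `i`, sends every such visit to another time. By
shift-invariance of `Q`, the law of the path seen from `τ`, multiplied by `m i`, has as its density
with respect to `Q` the number of visits sent to time `0` (mass transport). So `τ` embeds `ν` iff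
this number is `Q`-a.e. equal to `m i * ν x / m x`, where `x` is the state at time `0`; in
particular these ratios are then integers `k x`.

Conversely, given integers `k x`, let every visit to `i` supply one unit, let every visit to `x`
demand `k x` units, and serve each demand with the most recent units left. This matching sends each
visit to `i` to a stopping time. By recurrence, `Q` is conservative, so that a unit which is never
used and a demand which is never fully served cannot both occur with positive measure. If all
demands are served we are done; if all units are used, mass transport shows that the total supply
`m i` equals the total demand, so again all demands are served.
-/

noncomputable section

namespace TwoSided

open Filter Function

variable {S : Type*}

section Recurrence

variable {α : Type*} [MeasurableSpace α] {μ : Measure α} {f : α → α} {A s : Set α}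

theorem ae_mem_imp_frequently_iterate_mem (hf : Measure.QuasiMeasurePreserving f μ μ)
    (hA : ∀ᵐ x ∂μ, x ∈ A → ∃ n, f^[n + 1] x ∈ A) :
    ∀ᵐ x ∂μ, x ∈ A → ∃ᶠ n in atTop, f^[n] x ∈ A := by
  have hreturn : ∀ᵐ x ∂μ, ∀ k, f^[k] x ∈ A → ∃ n, f^[n + 1] (f^[k] x) ∈ A :=
    ae_all_iff.2 fun k => (hf.iterate k).ae hA
  filter_upwards [hreturn] with x hx hxA
  refine frequently_atTop.2 fun N => ?_
  induction N with
  | zero => exact ⟨0, le_rfl, hxA⟩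
  | succ N ih =>
    obtain ⟨k, hk, hkA⟩ := ih
    obtain ⟨n, hn⟩ := hx k hkA
    exact ⟨n + 1 + k, by lia, by rwa [iterate_add_apply]⟩

theorem sum_measure_inter_preimage_iterate_le (hf : MeasurePreserving f μ μ)
    (hA : MeasurableSet A) (hs : MeasurableSet s) (hwander : ∀ x ∈ s, ∀ n, f^[n + 1] x ∉ s)
    (N : ℕ) : ∑ k ∈ Finset.range N, μ (s ∩ f^[k] ⁻¹' A) ≤ μ A := by
  have hmeas (k : ℕ) : MeasurableSet (s ∩ f^[k] ⁻¹' A) := hs.inter ((hf.iterate k).measurable hA)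
  -- Pulling the `k`-th set back along `f^[N - k]` makes the sets disjoint subsets of `f^[N] ⁻¹' A`.
  calc ∑ k ∈ Finset.range N, μ (s ∩ f^[k] ⁻¹' A)
      = ∑ k ∈ Finset.range N, μ (f^[N - k] ⁻¹' (s ∩ f^[k] ⁻¹' A)) :=
        Finset.sum_congr rfl fun k _ =>
          ((hf.iterate (N - k)).measure_preimage (hmeas k).nullMeasurableSet).symm
    _ = μ (⋃ k ∈ Finset.range N, f^[N - k] ⁻¹' (s ∩ f^[k] ⁻¹' A)) := by
        refine (measure_biUnion_finset ?_ fun k _ => (hf.iterate _).measurable (hmeas k)).symm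
        have hdisj : ∀ k l, k < l → l < N → Disjoint (f^[N - k] ⁻¹' (s ∩ f^[k] ⁻¹' A))
            (f^[N - l] ⁻¹' (s ∩ f^[l] ⁻¹' A)) := by
          refine fun k l hkl hl => Set.disjoint_left.2 fun x hxk hxl => ?_
          have hsplit : N - k = l - k - 1 + 1 + (N - l) := by lia
          refine hwander _ hxl.1 (l - k - 1) ?_
          rw [← iterate_add_apply, ← hsplit]
          exact hxk.1
        intro k hk l hl hkl
        rcases hkl.lt_or_gt with h | h
        · exact hdisj k l h (Finset.mem_range.1 hl)
        · exact (hdisj l k h (Finset.mem_range.1 hk)).symm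
    _ ≤ μ (f^[N] ⁻¹' A) := by
        refine measure_mono (Set.iUnion₂_subset fun k hk x hx => ?_)
        have hmem : f^[k] (f^[N - k] x) ∈ A := hx.2
        rwa [← iterate_add_apply, Nat.add_sub_cancel' (Finset.mem_range.1 hk).le] at hmem
    _ = μ A := (hf.iterate N).measure_preimage hA.nullMeasurableSet

theorem measure_eq_zero_of_wandering (hf : MeasurePreserving f μ μ) (hA : MeasurableSet A)
    (hμA : μ A ≠ ∞) (hs : MeasurableSet s) (hwander : ∀ x ∈ s, ∀ n, f^[n + 1] x ∉ s)
    (hvisit : ∀ᵐ x ∂μ, x ∈ s → ∃ᶠ n in atTop, f^[n] x ∈ A) : μ s = 0 := by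
  have hsum : ∑' k, μ (s ∩ f^[k] ⁻¹' A) ≠ ∞ := by
    refine ne_top_of_le_ne_top hμA ?_
    rw [ENNReal.tsum_eq_iSup_nat]
    exact iSup_le fun N => sum_measure_inter_preimage_iterate_le hf hA hs hwander N
  refine measure_eq_zero_iff_ae_notMem.2 ?_
  filter_upwards [ae_eventually_notMem hsum, hvisit] with x hx hvisit hxs
  obtain ⟨n, hn, hnA⟩ := (hx.and_frequently (hvisit hxs)).exists
  exact hn ⟨hxs, hnA⟩

theorem conservative_of_iUnion_eq_univ {ι : Type*} [Countable ι] {A : ι → Set α}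
    (hf : MeasurePreserving f μ μ) (hA : ∀ j, MeasurableSet (A j)) (hμA : ∀ j, μ (A j) ≠ ∞)
    (hcover : ⋃ j, A j = Set.univ)
    (hreturn : ∀ j, ∀ᵐ x ∂μ, x ∈ A j → ∃ n, f^[n + 1] x ∈ A j) : Conservative f μ := by
  refine ⟨hf.quasiMeasurePreserving, fun s hs hs0 => ?_⟩
  by_contra! hwander
  refine hs0 ?_
  rw [← Set.inter_univ s, ← hcover, Set.inter_iUnion, measure_iUnion_null_iff]
  intro j
  refine measure_eq_zero_of_wandering hf (hA j) (hμA j) (hs.inter (hA j))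
    (fun x hx n hn => hwander x hx.1 _ n.succ_ne_zero hn.1) ?_
  filter_upwards [ae_mem_imp_frequently_iterate_mem hf.quasiMeasurePreserving (hreturn j)]
    with x hx hxs using hx hxs.2

end Recurrence

theorem measure_mem_and_of_ae_eq {α β : Type*} [MeasurableSpace α] (μ : β → Measure α) {g : α → β}
    {b : β} (hg : ∀ᵐ a ∂μ b, g a = b) (Z : Set β) (A : Set α) :
    μ b {a | g a ∈ Z ∧ a ∈ A} = Z.indicator (fun c => μ c A) b := by
  by_cases hb : b ∈ Z
  · rw [Set.indicator_of_mem hb]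
    refine measure_congr (eventuallyEq_set.2 ?_)
    filter_upwards [hg] with a ha using and_iff_right (ha.symm ▸ hb)
  · rw [Set.indicator_of_notMem hb]
    refine measure_mono_null ?_ (ae_iff.1 hg)
    exact fun a ha hab => hb (hab ▸ ha.1)

section Uniqueness

variable {ι : Type*}

theorem setOf_forall_mem_eq (t : Finset ι) (x : ι → S) :
    {ω : ι → S | ∀ k ∈ t, ω k = x k} = (t.restrict : (ι → S) → t → S) ⁻¹' {t.restrict x} := by
  ext ω
  simp [funext_iff]

variable [MeasurableSpace S] [MeasurableSingletonClass S]

theorem measurableSet_apply_eq (k : ι) (x : S) : MeasurableSet {ω : ι → S | ω k = x} :=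
  (measurable_pi_apply k : Measurable fun ω : ι → S => ω k) (.singleton x)

theorem measurableSet_forall_mem_eq (t : Finset ι) (x : ι → S) :
    MeasurableSet {ω : ι → S | ∀ k ∈ t, ω k = x k} := by
  rw [setOf_forall_mem_eq]
  exact Finset.measurable_restrict t (.singleton _)

variable [Countable S] {μ μ' : Measure (ι → S)}

theorem ext_of_forall_finset [IsFiniteMeasure μ]
    (h : ∀ s : Finset ι, ∃ t, s ⊆ t ∧ ∀ x : ι → S,
      μ {ω | ∀ k ∈ t, ω k = x k} = μ' {ω | ∀ k ∈ t, ω k = x k}) : μ = μ' := by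
  have hlim : IsProjectiveLimit μ' fun s => μ.map s.restrict := by
    intro s
    obtain ⟨t, hst, ht⟩ := h s
    have hmarg : μ'.map t.restrict = μ.map t.restrict := by
      refine Measure.ext_of_singleton fun y => ?_
      rw [Measure.map_apply (by fun_prop) (.singleton y),
        Measure.map_apply (by fun_prop) (.singleton y)]
      obtain hempty | ⟨x, rfl⟩ :=
        ((t.restrict : (ι → S) → t → S) ⁻¹' {y}).eq_empty_or_nonempty
      · simp only [hempty, measure_empty]
      · rw [← setOf_forall_mem_eq, ht]
    rw [← Finset.restrict₂_comp_restrict hst, ← Measure.map_map (by fun_prop) (by fun_prop), hmarg,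
      Measure.map_map (by fun_prop) (by fun_prop), Finset.restrict₂_comp_restrict hst]
  exact IsProjectiveLimit.unique (P := fun s => μ.map s.restrict) (fun _ => rfl) hlim

theorem ext_of_forall_finset_of_fiber (k₀ : ι) (hfin : ∀ z, μ {ω | ω k₀ = z} ≠ ∞)
    (h : ∀ s : Finset ι, ∃ t, s ⊆ t ∧ ∀ x : ι → S,
      μ {ω | ∀ k ∈ t, ω k = x k} = μ' {ω | ∀ k ∈ t, ω k = x k}) : μ = μ' := by
  classical
  refine Measure.ext_of_iUnion_eq_univ (s := fun z => {ω : ι → S | ω k₀ = z})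
    (Set.iUnion_eq_univ_iff.2 fun ω => ⟨ω k₀, rfl⟩) fun z => ?_
  have : IsFiniteMeasure (μ.restrict {ω | ω k₀ = z}) := ⟨by simpa using (hfin z).lt_top⟩
  refine ext_of_forall_finset fun s => ?_
  obtain ⟨t, hst, ht⟩ := h (insert k₀ s)
  refine ⟨t, (Finset.subset_insert k₀ s).trans hst, fun x => ?_⟩
  rw [Measure.restrict_apply (measurableSet_forall_mem_eq t x),
    Measure.restrict_apply (measurableSet_forall_mem_eq t x)]
  have hk₀ : k₀ ∈ t := hst (Finset.mem_insert_self k₀ s)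
  by_cases hz : x k₀ = z
  · have hsub : {ω : ι → S | ∀ k ∈ t, ω k = x k} ⊆ {ω | ω k₀ = z} := fun ω hω =>
      (hω k₀ hk₀).trans hz
    rw [Set.inter_eq_left.2 hsub, ht]
  · have hdisj : Disjoint {ω : ι → S | ∀ k ∈ t, ω k = x k} {ω | ω k₀ = z} :=
      Set.disjoint_left.2 fun ω hω hωz => hz ((hω k₀ hk₀).symm.trans hωz)
    rw [hdisj.inter_eq, measure_empty, measure_empty]

end Uniqueness

section OneSided

variable [MeasurableSpace S]

/-- The trajectory seen from time `1`. -/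
def tail (f : ℕ → S) : ℕ → S := fun n => f (n + 1)

@[fun_prop]
theorem measurable_tail : Measurable (tail : (ℕ → S) → ℕ → S) := by
  unfold tail; fun_prop

variable [MeasurableSingletonClass S]

theorem measurableSet_firstHit (y : S) (n : ℕ) :
    MeasurableSet {f : ℕ → S | f (n + 1) = y ∧ ∀ k < n, f (k + 1) ≠ y} := by
  measurability

variable [Countable S]

/-- The conditional law of the state at time `n + 1` given the states up to time `n`. -/
def stepKernel (p : S → PMF S) (n : ℕ) : Kernel (Finset.Iic n → S) S :=
  Kernel.ofFunOfCountable fun h => (p (h ⟨n, Finset.mem_Iic.2 le_rfl⟩)).toMeasure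

instance (p : S → PMF S) (n : ℕ) : IsMarkovKernel (stepKernel p n) :=
  ⟨fun h => inferInstanceAs (IsProbabilityMeasure (p (h ⟨n, _⟩)).toMeasure)⟩

/-- The law on one-sided path space of the chain with transition matrix `p` started in `x`. -/
def chainLaw (p : S → PMF S) (x : S) : Measure (ℕ → S) :=
  Kernel.traj (X := fun _ => S) (stepKernel p) 0 fun _ => x

variable (p : S → PMF S)

instance (x : S) : IsProbabilityMeasure (chainLaw p x) :=
  inferInstanceAs (IsProbabilityMeasure (Kernel.traj (X := fun _ => S) (stepKernel p) 0 _))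

theorem chainLaw_map_frestrictLe_zero (x : S) :
    (chainLaw p x).map (Preorder.frestrictLe (π := fun _ => S) 0) = Measure.dirac fun _ => x :=
  (Kernel.traj_map_frestrictLe_apply ..).trans <| by rw [Kernel.partialTraj_self, Kernel.id_apply]

theorem chainLaw_map_frestrictLe_succ (x : S) (n : ℕ) :
    (chainLaw p x).map (fun f => (Preorder.frestrictLe (π := fun _ => S) n f, f (n + 1))) =
      (chainLaw p x).map (Preorder.frestrictLe n) ⊗ₘ stepKernel p n := by
  rw [chainLaw, Kernel.traj_map_frestrictLe_apply, Kernel.partialTraj_compProd_eq_map_traj zero_le]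

theorem chainLaw_initial_block (x : S) (n : ℕ) (y : ℕ → S) :
    chainLaw p x {f | ∀ k ∈ Finset.Iic n, f k = y k} =
      PMF.pure x (y 0) * ∏ k ∈ Finset.range n, p (y k) (y (k + 1)) := by
  classical
  induction n with
  | zero =>
    have hpre : {f : ℕ → S | ∀ k ∈ Finset.Iic 0, f k = y k} =
        Preorder.frestrictLe (π := fun _ => S) 0 ⁻¹' {fun _ => y 0} := by
      ext f
      simp [funext_iff]
    rw [hpre, ← Measure.map_apply (by fun_prop) (.singleton _), chainLaw_map_frestrictLe_zero]
    simp [PMF.pure_apply, Set.indicator_apply, funext_iff, eq_comm]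
  | succ n ih =>
    have hpre : {f : ℕ → S | ∀ k ∈ Finset.Iic (n + 1), f k = y k} =
        (fun f => (Preorder.frestrictLe (π := fun _ => S) n f, f (n + 1))) ⁻¹'
          ({Preorder.frestrictLe n y} ×ˢ {y (n + 1)}) := by
      ext f
      simp [funext_iff]
      grind
    rw [hpre, ← Measure.map_apply (by fun_prop) (.prod (.singleton _) (.singleton _)),
      chainLaw_map_frestrictLe_succ, Measure.compProd_apply_prod (.singleton _) (.singleton _),
      lintegral_singleton, Measure.map_apply (by fun_prop) (.singleton _)]
    have hstep : stepKernel p n (Preorder.frestrictLe n y) {y (n + 1)} = p (y n) (y (n + 1)) :=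
      PMF.toMeasure_apply_singleton _ _ (.singleton _)
    have hhead : Preorder.frestrictLe (π := fun _ => S) n ⁻¹' {Preorder.frestrictLe n y} =
        {f | ∀ k ∈ Finset.Iic n, f k = y k} := (setOf_forall_mem_eq _ _).symm
    rw [hstep, hhead, ih, Finset.prod_range_succ]
    ring

theorem ext_of_forall_Iic {μ μ' : Measure (ℕ → S)} [IsFiniteMeasure μ]
    (h : ∀ n (y : ℕ → S), μ {f | ∀ k ∈ Finset.Iic n, f k = y k} =
      μ' {f | ∀ k ∈ Finset.Iic n, f k = y k}) : μ = μ' :=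
  ext_of_forall_finset fun s =>
    ⟨Finset.Iic (s.sup id), fun _ hk => Finset.mem_Iic.2 (Finset.le_sup (f := id) hk), h _⟩

theorem chainLaw_ae_zero (x : S) : ∀ᵐ f ∂chainLaw p x, f 0 = x := by
  have hblock := chainLaw_initial_block p x 0 fun _ => x
  rw [PMF.pure_apply_self, Finset.prod_range_zero, mul_one] at hblock
  filter_upwards [(mem_ae_iff_prob_eq_one (measurableSet_forall_mem_eq _ _)).2 hblock] with f hf
    using hf 0 (Finset.mem_Iic.2 le_rfl)

theorem chainLaw_initial_and (x : S) (Z : Set S) (G : Set (ℕ → S)) :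
    chainLaw p x {f | f 0 ∈ Z ∧ f ∈ G} = Z.indicator (fun z => chainLaw p z G) x :=
  measure_mem_and_of_ae_eq (fun z => chainLaw p z) (chainLaw_ae_zero p x) Z G

theorem chainLaw_map_tail (x : S) :
    (chainLaw p x).map tail = Measure.sum fun z => p x z • chainLaw p z := by
  refine ext_of_forall_Iic fun n y => ?_
  have hshift : chainLaw p x (tail ⁻¹' {f | ∀ k ∈ Finset.Iic n, f k = y k}) =
      chainLaw p x {f | ∀ k ∈ Finset.Iic (n + 1), f k = Nat.casesOn k x y} := by
    refine measure_congr (eventuallyEq_set.2 ?_)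
    filter_upwards [chainLaw_ae_zero p x] with f hf
    simp only [Set.mem_preimage, tail, Set.mem_ofPred_eq, Finset.mem_Iic]
    refine ⟨fun h k hk => ?_, fun h k hk => h (k + 1) (by lia)⟩
    cases k with
    | zero => exact hf
    | succ k => exact h k (by lia)
  have hcyl := measurableSet_forall_mem_eq (Finset.Iic n) y
  rw [Measure.map_apply measurable_tail hcyl, hshift, chainLaw_initial_block,
    Measure.sum_apply _ hcyl, Finset.prod_range_succ']
  simp only [Measure.smul_apply, chainLaw_initial_block, smul_eq_mul]
  rw [tsum_eq_single (y 0) fun z hz => by rw [PMF.pure_apply_of_ne _ _ hz.symm, zero_mul, mul_zero]]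
  simp only [Nat.rec_zero, PMF.pure_apply_self, one_mul]
  exact mul_comm ..

theorem chainLaw_preimage_tail (x : S) {G : Set (ℕ → S)} (hG : MeasurableSet G) :
    chainLaw p x (tail ⁻¹' G) = ∑' z, p x z * chainLaw p z G := by
  rw [← Measure.map_apply measurable_tail hG, chainLaw_map_tail, Measure.sum_apply _ hG]
  rfl

theorem chainLaw_inter_tail_iterate (n : ℕ) (x y : S) {G : Set (ℕ → S)} (hG : MeasurableSet G) :
    chainLaw p x {f | f n = y ∧ tail^[n] f ∈ G} = stepDist p n x y * chainLaw p y G := by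
  classical
  induction n generalizing x with
  | zero =>
    refine (chainLaw_initial_and p x {y} G).trans ?_
    obtain rfl | hyx := eq_or_ne y x
    · simp [stepDist]
    · simp [stepDist, hyx, hyx.symm]
  | succ n ih =>
    have hmeas : MeasurableSet {f : ℕ → S | f n = y ∧ tail^[n] f ∈ G} :=
      (measurableSet_apply_eq n y).inter (measurable_tail.iterate n hG)
    rw [stepDist, PMF.bind_apply, ← ENNReal.tsum_mul_right]
    simp_rw [mul_assoc, ← ih]
    exact chainLaw_preimage_tail p x hmeas

theorem chainLaw_firstHit (x y : S) (n : ℕ) :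
    chainLaw p x {f | f (n + 1) = y ∧ ∀ k < n, f (k + 1) ≠ y} = firstHitProb p y n x := by
  classical
  induction n generalizing x with
  | zero =>
    have hone := chainLaw_inter_tail_iterate p 1 x y .univ
    simp only [stepDist, PMF.bind_pure, measure_univ, mul_one, Set.mem_univ, and_true] at hone
    simpa only [firstHitProb, zero_add, Nat.not_lt_zero, false_imp_iff, implies_true, and_true]
  | succ n ih =>
    have hpre : {f : ℕ → S | f (n + 1 + 1) = y ∧ ∀ k < n + 1, f (k + 1) ≠ y} =
        tail ⁻¹' {f | f 0 ≠ y ∧ f (n + 1) = y ∧ ∀ k < n, f (k + 1) ≠ y} := by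
      ext f
      simp only [Set.mem_ofPred_eq, Set.mem_preimage, tail, Nat.forall_lt_succ_left', zero_add]
      tauto
    have hmeas : MeasurableSet {f : ℕ → S | f 0 ≠ y ∧ f (n + 1) = y ∧ ∀ k < n, f (k + 1) ≠ y} :=
      (measurableSet_apply_eq 0 y).compl.inter (measurableSet_firstHit y n)
    rw [hpre, chainLaw_preimage_tail p x hmeas, firstHitProb]
    refine (tsum_congr fun z => ?_).trans
      (tsum_subtype {z | z ≠ y} fun z => p x z * firstHitProb p y n z).symm
    rw [Set.indicator_mul_right, ← funext ih]
    exact congrArg _ (chainLaw_initial_and p z {z | z ≠ y} _)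

theorem chainLaw_ae_return (hrec : IsRecurrent p) (x : S) :
    ∀ᵐ f ∂chainLaw p x, ∃ n, f (n + 1) = x := by
  have hmeas := measurableSet_firstHit (S := S) x
  have hdisj : Pairwise (Disjoint on fun n =>
      {f : ℕ → S | f (n + 1) = x ∧ ∀ k < n, f (k + 1) ≠ x}) := by
    refine (pairwise_disjoint_on _).2 fun a b hab => Set.disjoint_left.2 fun f ha hb => ?_
    exact hb.2 a hab ha.1
  have hone : chainLaw p x (⋃ n, {f | f (n + 1) = x ∧ ∀ k < n, f (k + 1) ≠ x}) = 1 := by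
    rw [measure_iUnion hdisj hmeas]
    simp_rw [chainLaw_firstHit]
    exact hrec x
  filter_upwards [(mem_ae_iff_prob_eq_one (.iUnion hmeas)).2 hone] with f hf
  obtain ⟨n, hn⟩ := Set.mem_iUnion.1 hf
  exact ⟨n, hn.1⟩

end OneSided

section TwoSidedLaw

theorem IsStationary.coe_ne_zero {p : S → PMF S} {m : S → ℝ≥0} (hm : IsStationary p m) (x : S) :
    (m x : ℝ≥0∞) ≠ 0 :=
  ENNReal.coe_ne_zero.2 (hm.1 x).ne'

theorem IsStationary.mul_dual {p : S → PMF S} {m : S → ℝ≥0} (hm : IsStationary p m) (x y : S) :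
    (m x : ℝ≥0∞) * dual p m x y = m y * p y x := by
  rw [dual, ← mul_assoc, ENNReal.mul_div_cancel (hm.coe_ne_zero x) ENNReal.coe_ne_top]

/-- The transition matrix `dual p m` of the time reversal, as a family of probability
mass functions. -/
def dualPMF (p : S → PMF S) (m : S → ℝ≥0) (hm : IsStationary p m) (x : S) : PMF S :=
  ⟨dual p m x, by
    have hsum : ∑' y, dual p m x y = 1 := by
      simp only [dual, ENNReal.div_eq_inv_mul, mul_assoc]
      rw [ENNReal.tsum_mul_left, hm.2 x,
        ENNReal.inv_mul_cancel (hm.coe_ne_zero x) ENNReal.coe_ne_top]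
    exact hsum ▸ ENNReal.summable.hasSum⟩

theorem dualPMF_apply (p : S → PMF S) (m : S → ℝ≥0) (hm : IsStationary p m) (x y : S) :
    dualPMF p m hm x y = dual p m x y := rfl

/-- The states at the times `0, -1, -2, …`. -/
def past (ω : ℤ → S) : ℕ → S := fun n => ω (-n)

/-- The states at the times `0, 1, 2, …`. -/
def future (ω : ℤ → S) : ℕ → S := fun n => ω n

/-- The two-sided path with past `f` and future `g`; the value at time `0` is taken from `g`. -/
def glue (f g : ℕ → S) : ℤ → S
  | .ofNat n => g n
  | .negSucc n => f (n + 1)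

theorem future_glue (f g : ℕ → S) : future (glue f g) = g := rfl

theorem past_glue {f g : ℕ → S} (h : f 0 = g 0) : past (glue f g) = f := by
  funext n
  cases n with
  | zero => exact h.symm
  | succ n => rfl

variable [MeasurableSpace S]

@[fun_prop]
theorem measurable_past : Measurable (past : (ℤ → S) → ℕ → S) := by
  unfold past; fun_prop

@[fun_prop]
theorem measurable_future : Measurable (future : (ℤ → S) → ℕ → S) := by
  unfold future; fun_prop

theorem measurable_uncurry_glue : Measurable (uncurry (glue : (ℕ → S) → (ℕ → S) → ℤ → S)) := by
  refine measurable_pi_lambda _ fun n => ?_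
  cases n with
  | ofNat n => exact (measurable_pi_apply n).comp measurable_snd
  | negSucc n => exact (measurable_pi_apply (n + 1)).comp measurable_fst

variable [Countable S] [MeasurableSingletonClass S] (p : S → PMF S) (m : S → ℝ≥0)
  (hm : IsStationary p m)

/-- The law on path space of the two-sided chain started in `x`. -/
def pathLaw (x : S) : Measure (ℤ → S) :=
  ((chainLaw (dualPMF p m hm) x).prod (chainLaw p x)).map (uncurry glue)

instance (x : S) : IsProbabilityMeasure (pathLaw p m hm x) :=
  Measure.isProbabilityMeasure_map measurable_uncurry_glue.aemeasurable

theorem pathLaw_past_future (x : S) {F G : Set (ℕ → S)} (hF : MeasurableSet F)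
    (hG : MeasurableSet G) :
    pathLaw p m hm x {ω | past ω ∈ F ∧ future ω ∈ G} =
      chainLaw (dualPMF p m hm) x F * chainLaw p x G := by
  have hstart : ∀ᵐ q ∂(chainLaw (dualPMF p m hm) x).prod (chainLaw p x), q.1 0 = q.2 0 := by
    filter_upwards [Measure.quasiMeasurePreserving_fst.ae (chainLaw_ae_zero (dualPMF p m hm) x),
      Measure.quasiMeasurePreserving_snd.ae (chainLaw_ae_zero p x)] with q hq₁ hq₂
      using hq₁.trans hq₂.symm
  have hmeas : MeasurableSet {ω : ℤ → S | past ω ∈ F ∧ future ω ∈ G} :=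
    (measurable_past hF).inter (measurable_future hG)
  rw [pathLaw, Measure.map_apply measurable_uncurry_glue hmeas, ← Measure.prod_prod]
  refine measure_congr (eventuallyEq_set.2 ?_)
  filter_upwards [hstart] with q hq
  simp only [Set.mem_preimage, Set.mem_ofPred_eq, uncurry, past_glue hq, future_glue, Set.mem_prod]

theorem measurePreserving_past (x : S) :
    MeasurePreserving past (pathLaw p m hm x) (chainLaw (dualPMF p m hm) x) := by
  refine ⟨measurable_past, Measure.ext fun F hF => ?_⟩
  rw [Measure.map_apply measurable_past hF]
  simpa [Set.preimage] using pathLaw_past_future p m hm x hF .univ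

theorem measurePreserving_future (x : S) :
    MeasurePreserving future (pathLaw p m hm x) (chainLaw p x) := by
  refine ⟨measurable_future, Measure.ext fun G hG => ?_⟩
  rw [Measure.map_apply measurable_future hG]
  simpa [Set.preimage] using pathLaw_past_future p m hm x .univ hG

theorem pathLaw_ae_zero (x : S) : ∀ᵐ ω ∂pathLaw p m hm x, ω 0 = x :=
  (measurePreserving_future p m hm x).quasiMeasurePreserving.ae (chainLaw_ae_zero p x)

theorem pathLaw_block (z : S) (a b : ℕ) (x : ℤ → S) :
    pathLaw p m hm z {ω | ∀ k ∈ Finset.Icc (-a : ℤ) b, ω k = x k} =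
      PMF.pure z (x 0) * (∏ k ∈ Finset.range b, p (x (k : ℤ)) (x ((k : ℤ) + 1)))
        * ∏ k ∈ Finset.range a, dual p m (x (-(k : ℤ))) (x (-(k : ℤ) - 1)) := by
  have hsplit : {ω : ℤ → S | ∀ k ∈ Finset.Icc (-a : ℤ) b, ω k = x k} =
      {ω | past ω ∈ {f | ∀ k ∈ Finset.Iic a, f k = past x k} ∧
        future ω ∈ {f | ∀ k ∈ Finset.Iic b, f k = future x k}} := by
    ext ω
    simp only [Set.mem_ofPred_eq, Finset.mem_Icc, Finset.mem_Iic, past, future]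
    refine ⟨fun h => ⟨fun k hk => h _ (by lia), fun k hk => h _ (by lia)⟩, fun h k hk => ?_⟩
    obtain ⟨n, rfl | rfl⟩ := k.eq_nat_or_neg
    · exact h.2 n (by lia)
    · exact h.1 n (by lia)
  have hpure : PMF.pure z (x 0) * PMF.pure z (x 0) = PMF.pure z (x 0) := by
    classical
    rw [PMF.pure_apply]
    split_ifs <;> simp
  have hpast (k : ℕ) : past x (k + 1) = x (-(k : ℤ) - 1) := congrArg x (by lia)
  rw [hsplit, pathLaw_past_future p m hm z (measurableSet_forall_mem_eq _ _)
    (measurableSet_forall_mem_eq _ _), chainLaw_initial_block, chainLaw_initial_block]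
  simp only [hpast, dualPMF_apply]
  simp only [past, future, Nat.cast_zero, neg_zero, Nat.cast_succ]
  rw [mul_mul_mul_comm, hpure, mul_assoc, mul_comm (∏ k ∈ Finset.range a, _)]

/-- The mixture, with weights `w`, of the laws of the two-sided chain started in the single states.
It is the law with initial distribution `w` if `w` is a probability mass function, and the infinite
measure of the stationary chain if `w = m`. -/
def mixLaw (w : S → ℝ≥0∞) : Measure (ℤ → S) :=
  Measure.sum fun x => w x • pathLaw p m hm x

variable (w : S → ℝ≥0∞)

theorem mixLaw_apply {A : Set (ℤ → S)} (hA : MeasurableSet A) :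
    mixLaw p m hm w A = ∑' z, w z * pathLaw p m hm z A := by
  simp only [mixLaw, Measure.sum_apply _ hA, Measure.smul_apply, smul_eq_mul]

theorem mixLaw_pure (i : S) : mixLaw p m hm (PMF.pure i) = pathLaw p m hm i := by
  ext A hA
  rw [mixLaw_apply p m hm _ hA, tsum_eq_single i]
  · rw [PMF.pure_apply_self, one_mul]
  · intro j hj
    rw [PMF.pure_apply_of_ne _ _ hj, zero_mul]

instance (ν : PMF S) : IsProbabilityMeasure (mixLaw p m hm ν) :=
  ⟨by simp only [mixLaw_apply p m hm _ .univ, measure_univ, mul_one, ν.tsum_coe]⟩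

theorem mixLaw_block (a b : ℕ) (x : ℤ → S) :
    mixLaw p m hm w {ω | ∀ k ∈ Finset.Icc (-a : ℤ) b, ω k = x k} =
      w (x 0) * (∏ k ∈ Finset.range b, p (x (k : ℤ)) (x ((k : ℤ) + 1)))
        * ∏ k ∈ Finset.range a, dual p m (x (-(k : ℤ))) (x (-(k : ℤ) - 1)) := by
  rw [mixLaw_apply p m hm w (measurableSet_forall_mem_eq _ _), tsum_eq_single (x 0)]
  · rw [pathLaw_block, PMF.pure_apply_self, one_mul, mul_assoc]
  · intro z hz
    rw [pathLaw_block, PMF.pure_apply_of_ne _ _ hz.symm, zero_mul, zero_mul, mul_zero]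

theorem mixLaw_initial_and (z : S) {A : Set (ℤ → S)} (hA : MeasurableSet A) :
    mixLaw p m hm w {ω | ω 0 = z ∧ ω ∈ A} = w z * pathLaw p m hm z A := by
  have hmeas : MeasurableSet {ω : ℤ → S | ω 0 = z ∧ ω ∈ A} := (measurableSet_apply_eq 0 z).inter hA
  have hfiber (y : S) : pathLaw p m hm y {ω | ω 0 = z ∧ ω ∈ A} =
      ({z} : Set S).indicator (fun y => pathLaw p m hm y A) y :=
    measure_mem_and_of_ae_eq (fun y => pathLaw p m hm y) (pathLaw_ae_zero p m hm y) {z} A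
  rw [mixLaw_apply p m hm w hmeas, tsum_eq_single z, hfiber,
    Set.indicator_of_mem (Set.mem_singleton z)]
  intro y hy
  rw [hfiber, Set.indicator_of_notMem (Set.mem_singleton_iff.not.2 hy), mul_zero]

theorem mixLaw_initial (z : S) : mixLaw p m hm w {ω | ω 0 = z} = w z := by
  simpa using mixLaw_initial_and p m hm w z .univ

theorem sigmaFinite_mixLaw (hw : ∀ x, w x ≠ ∞) : SigmaFinite (mixLaw p m hm w) := by
  refine Measure.sigmaFinite_of_countable (S := Set.range fun z => {ω : ℤ → S | ω 0 = z})
    (Set.countable_range _) ?_ ?_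
  · rintro _ ⟨z, rfl⟩
    exact (mixLaw_initial p m hm w z).trans_lt (hw z).lt_top
  · exact Set.sUnion_eq_univ_iff.2 fun ω => ⟨_, ⟨ω 0, rfl⟩, rfl⟩

theorem mixLaw_mul (v : S → ℝ≥0∞) :
    mixLaw p m hm (fun x => v x * w x) = (mixLaw p m hm w).withDensity fun ω => v (ω 0) := by
  have hv (x : S) : (pathLaw p m hm x).withDensity (fun ω => v (ω 0)) = v x • pathLaw p m hm x := by
    rw [← withDensity_const]
    refine withDensity_congr_ae ?_
    filter_upwards [pathLaw_ae_zero p m hm x] with ω hω using congrArg v hω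
  rw [mixLaw, mixLaw, withDensity_sum]
  simp_rw [withDensity_smul_measure, hv, smul_smul, mul_comm]

theorem ext_of_forall_Icc {μ μ' : Measure (ℤ → S)} (hfin : ∀ z, μ {ω | ω 0 = z} ≠ ∞)
    (h : ∀ (a b : ℕ) (x : ℤ → S), μ {ω | ∀ k ∈ Finset.Icc (-a : ℤ) b, ω k = x k} =
      μ' {ω | ∀ k ∈ Finset.Icc (-a : ℤ) b, ω k = x k}) : μ = μ' := by
  refine ext_of_forall_finset_of_fiber 0 hfin fun s => ?_
  have hle {k : ℤ} (hk : k ∈ s) : k.natAbs ≤ s.sup Int.natAbs := Finset.le_sup hk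
  exact ⟨Finset.Icc (-(s.sup Int.natAbs : ℕ)) (s.sup Int.natAbs : ℕ),
    fun k hk => Finset.mem_Icc.2 (by grind), h _ _⟩

end TwoSidedLaw

section Shift

/-- The path seen from time `n`. -/
def shift (n : ℤ) (ω : ℤ → S) : ℤ → S := fun k => ω (k + n)

theorem shift_zero : (shift 0 : (ℤ → S) → ℤ → S) = id := by
  funext ω k
  exact congrArg ω (add_zero k)

theorem shift_shift (n k : ℤ) (ω : ℤ → S) : shift n (shift k ω) = shift (n + k) ω := by
  funext l
  exact congrArg ω (add_assoc l n k)

theorem iterate_shift_one (n : ℕ) : (shift 1 : (ℤ → S) → ℤ → S)^[n] = shift n := by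
  induction n with
  | zero => exact shift_zero.symm
  | succ n ih =>
    funext ω
    rw [iterate_succ_apply', ih, shift_shift, Nat.cast_succ, add_comm]

variable [MeasurableSpace S]

@[fun_prop]
theorem measurable_shift (n : ℤ) : Measurable (shift (S := S) n) := by
  unfold shift; fun_prop

variable [Countable S] [MeasurableSingletonClass S] (p : S → PMF S) (m : S → ℝ≥0)
  (hm : IsStationary p m)

/-- The law of the two-sided stationary chain, an infinite measure if `m` has infinite mass. -/
def stationaryLaw : Measure (ℤ → S) := mixLaw p m hm fun x => m x

instance : SigmaFinite (stationaryLaw p m hm) :=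
  sigmaFinite_mixLaw p m hm _ fun _ => ENNReal.coe_ne_top

theorem measurePreserving_shift_one :
    MeasurePreserving (shift 1) (stationaryLaw p m hm) (stationaryLaw p m hm) := by
  refine ⟨measurable_shift 1, (ext_of_forall_finset_of_fiber 0 (fun z => ?_) fun s => ?_).symm⟩
  · exact (mixLaw_initial p m hm _ z).trans_ne ENNReal.coe_ne_top
  have hle {k : ℤ} (hk : k ∈ s) : k.natAbs ≤ s.sup Int.natAbs := Finset.le_sup hk
  set a := s.sup Int.natAbs
  refine ⟨Finset.Icc (-(a + 1 : ℕ) : ℤ) a, fun k hk => Finset.mem_Icc.2 (by grind), fun x => ?_⟩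
  have hpre : shift 1 ⁻¹' {ω : ℤ → S | ∀ k ∈ Finset.Icc (-(a + 1 : ℕ) : ℤ) a, ω k = x k} =
      {ω | ∀ k ∈ Finset.Icc (-a : ℤ) (a + 1 : ℕ), ω k = shift (-1) x k} := by
    ext ω
    simp only [Set.mem_preimage, Set.mem_ofPred_eq, Finset.mem_Icc, shift]
    refine ⟨fun h k hk => ?_, fun h k hk => ?_⟩
    · simpa using h (k + -1) (by lia)
    · simpa using h (k + 1) (by lia)
  rw [Measure.map_apply (measurable_shift 1) (measurableSet_forall_mem_eq _ _), hpre,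
    stationaryLaw, mixLaw_block, mixLaw_block, Finset.prod_range_succ', Finset.prod_range_succ']
  have hfuture : ∏ k ∈ Finset.range a, p (shift (-1) x ((k + 1 : ℕ) : ℤ))
      (shift (-1) x ((k + 1 : ℕ) + 1 : ℤ)) =
      ∏ k ∈ Finset.range a, p (x (k : ℤ)) (x ((k : ℤ) + 1)) :=
    Finset.prod_congr rfl fun k _ => by unfold shift; congr 2 <;> lia
  have hpast : ∏ k ∈ Finset.range a, dual p m (x (-(k + 1 : ℕ) : ℤ)) (x (-(k + 1 : ℕ) - 1 : ℤ)) =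
      ∏ k ∈ Finset.range a, dual p m (shift (-1) x (-(k : ℤ))) (shift (-1) x (-(k : ℤ) - 1)) :=
    Finset.prod_congr rfl fun k _ => by unfold shift; congr 2 <;> lia
  rw [hfuture, hpast]
  -- The two block weights differ in the step between the times `-1` and `0` only.
  have hstep : (m (x 0) : ℝ≥0∞) * dual p m (x (-(0 : ℕ) : ℤ)) (x (-(0 : ℕ) - 1 : ℤ)) =
      m (shift (-1) x 0) * p (shift (-1) x ((0 : ℕ) : ℤ)) (shift (-1) x ((0 : ℕ) + 1 : ℤ)) := by
    simpa [shift] using hm.mul_dual (x 0) (x (-1))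
  rw [mul_mul_mul_comm, mul_comm (∏ k ∈ Finset.range a, p (x _) _), mul_mul_mul_comm,
    hstep]
  ring

theorem measurePreserving_shift (n : ℤ) :
    MeasurePreserving (shift n) (stationaryLaw p m hm) (stationaryLaw p m hm) := by
  have hnat (n : ℕ) : MeasurePreserving (shift n) (stationaryLaw p m hm) (stationaryLaw p m hm) :=
    iterate_shift_one (S := S) n ▸ (measurePreserving_shift_one p m hm).iterate n
  obtain ⟨n, rfl | rfl⟩ := n.eq_nat_or_neg
  · exact hnat n
  · refine ⟨measurable_shift _, ?_⟩
    nth_rw 1 [← (hnat n).map_eq]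
    have hinv : shift (-n : ℤ) ∘ shift (S := S) n = id := by
      funext ω
      rw [comp_apply, shift_shift, neg_add_cancel, shift_zero]
    rw [Measure.map_map (by fun_prop) (by fun_prop), hinv, Measure.map_id]

theorem ae_stationaryLaw_iff {P : (ℤ → S) → Prop} :
    (∀ᵐ ω ∂stationaryLaw p m hm, P ω) ↔ ∀ j, ∀ᵐ ω ∂pathLaw p m hm j, P ω := by
  rw [stationaryLaw, mixLaw, Measure.ae_sum_iff]
  exact forall_congr' fun j => Measure.ae_ennreal_smul_measure_iff (hm.coe_ne_zero j)

theorem conservative_shift_one (hrec : IsRecurrent p) :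
    Conservative (shift 1) (stationaryLaw p m hm) := by
  refine conservative_of_iUnion_eq_univ (A := fun j => {ω : ℤ → S | ω 0 = j})
    (measurePreserving_shift_one p m hm) (measurableSet_apply_eq 0)
    (fun j => (mixLaw_initial p m hm _ j).trans_ne ENNReal.coe_ne_top)
    (Set.iUnion_eq_univ_iff.2 fun ω => ⟨ω 0, rfl⟩) fun j => ?_
  refine (ae_stationaryLaw_iff p m hm).2 fun x => ?_
  have hreturn := (measurePreserving_future p m hm x).quasiMeasurePreserving.ae
    (chainLaw_ae_return p hrec x)
  filter_upwards [pathLaw_ae_zero p m hm x, hreturn] with ω hω ⟨n, hn⟩ hj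
  refine ⟨n, ?_⟩
  rw [iterate_shift_one]
  exact (congrArg ω (zero_add _)).trans (hn.trans (hω.symm.trans hj))

end Shift

section MassTransport

/-- The path seen from the random time `τ`, and from time `0` where `τ` is infinite. -/
def jump (τ : (ℤ → S) → WithTop ℤ) (ω : ℤ → S) : ℤ → S := shift ((τ ω).untopD 0) ω

/-- The set of `k` such that the path visits `i` at time `-k` and `τ`, applied to the path seen from
there, points to time `0`. -/
def sources (i : S) (τ : (ℤ → S) → WithTop ℤ) (ω : ℤ → S) : Set ℤ :=
  {k | ω (-k) = i ∧ τ (shift (-k) ω) = k}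

/-- The number of visits to `i` which `τ` sends to time `0`. -/
def intake (i : S) (τ : (ℤ → S) → WithTop ℤ) (ω : ℤ → S) : ℝ≥0∞ := (sources i τ ω).encard

theorem mem_sources_shift_iff {i : S} {τ : (ℤ → S) → WithTop ℤ} {ω : ℤ → S} {k : ℤ} :
    k ∈ sources i τ (shift k ω) ↔ ω 0 = i ∧ τ ω = k := by
  simp only [sources, Set.mem_ofPred_eq, shift_shift, neg_add_cancel, shift_zero, id_eq]
  simp only [shift, neg_add_cancel]

theorem intake_eq_tsum (i : S) (τ : (ℤ → S) → WithTop ℤ) :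
    intake i τ = ∑' k, {ω | k ∈ sources i τ ω}.indicator 1 := by
  funext ω
  rw [intake, ENNReal.tsum_apply]
  exact (ENNReal.tsum_set_one _).symm.trans (tsum_subtype (sources i τ ω) fun _ => 1)

/-- The number of visits to `i` which have to be sent to each visit to `x` in order that the path
seen from there has initial distribution `ν`. -/
def demand (m : S → ℝ≥0) (i : S) (ν : PMF S) (x : S) : ℝ≥0∞ := m i * ν x / m x

theorem demand_ne_top {p : S → PMF S} {m : S → ℝ≥0} (hm : IsStationary p m) (i : S) (ν : PMF S)
    (x : S) : demand m i ν x ≠ ∞ :=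
  ENNReal.div_ne_top (ENNReal.mul_ne_top ENNReal.coe_ne_top (ν.apply_ne_top x)) (hm.coe_ne_zero x)

variable [MeasurableSpace S]

theorem measurable_jump {τ : (ℤ → S) → WithTop ℤ} (hτ : Measurable τ) : Measurable (jump τ) := by
  have hshift : Measurable fun q : (ℤ → S) × ℤ => shift q.2 q.1 :=
    measurable_from_prod_countable_left measurable_shift
  exact hshift.comp (measurable_id.prodMk (hτ.untopD 0))

variable [MeasurableSingletonClass S] (i : S) {τ : (ℤ → S) → WithTop ℤ} (hτ : Measurable τ)

include hτ

theorem measurableSet_mem_sources (k : ℤ) : MeasurableSet {ω | k ∈ sources i τ ω} :=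
  (measurableSet_apply_eq (-k) i).inter
    ((hτ.comp (measurable_shift (-k))) (.singleton (k : WithTop ℤ)))

theorem measurable_intake : Measurable (intake i τ) := by
  rw [intake_eq_tsum]
  exact Measurable.tsum' fun k => measurable_one.indicator (measurableSet_mem_sources i hτ k)

theorem withDensity_intake (μ : Measure (ℤ → S)) :
    μ.withDensity (intake i τ) = Measure.sum fun k => μ.restrict {ω | k ∈ sources i τ ω} := by
  have hmeas := measurableSet_mem_sources i hτ
  rw [intake_eq_tsum, withDensity_tsum fun k => measurable_one.indicator (hmeas k)]
  simp_rw [withDensity_indicator_one (hmeas _)]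

variable [Countable S] (p : S → PMF S) (m : S → ℝ≥0) (hm : IsStationary p m)

theorem mass_transport :
    m i • ((pathLaw p m hm i).restrict {ω | τ ω ≠ ⊤}).map (jump τ) =
      (stationaryLaw p m hm).withDensity (intake i τ) := by
  have hfin : MeasurableSet {ω | τ ω ≠ ⊤} := (hτ (.singleton ⊤)).compl
  have hjump := measurable_jump hτ
  have hmeas := measurableSet_mem_sources i hτ
  rw [withDensity_intake i hτ]
  ext A hA
  have hunion : {ω : ℤ → S | ω 0 = i ∧ ω ∈ jump τ ⁻¹' A ∩ {ω | τ ω ≠ ⊤}} =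
      ⋃ k : ℤ, shift k ⁻¹' (A ∩ {ω | k ∈ sources i τ ω}) := by
    ext ω
    simp only [Set.mem_iUnion, Set.mem_preimage, Set.mem_inter_iff, Set.mem_ofPred_eq,
      mem_sources_shift_iff, jump]
    cases hω : τ ω with
    | top => simp
    | coe k => simp [and_comm]
  have hdisj : Pairwise (Disjoint on fun k : ℤ =>
      shift k ⁻¹' (A ∩ {ω | k ∈ sources i τ ω})) := by
    refine fun a b hab => Set.disjoint_left.2 fun ω ha hb => hab ?_
    exact WithTop.coe_injective ((mem_sources_shift_iff.1 ha.2).2.symm.trans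
      (mem_sources_shift_iff.1 hb.2).2)
  calc (m i • ((pathLaw p m hm i).restrict {ω | τ ω ≠ ⊤}).map (jump τ)) A
      = m i * pathLaw p m hm i (jump τ ⁻¹' A ∩ {ω | τ ω ≠ ⊤}) := by
        rw [Measure.smul_apply, Measure.map_apply hjump hA, Measure.restrict_apply (hjump hA)]
        rfl
    _ = stationaryLaw p m hm (⋃ k : ℤ, shift k ⁻¹' (A ∩ {ω | k ∈ sources i τ ω})) := by
        rw [← hunion]
        exact (mixLaw_initial_and p m hm (fun x => m x) i ((hjump hA).inter hfin)).symm
    _ = ∑' k : ℤ, stationaryLaw p m hm (A ∩ {ω | k ∈ sources i τ ω}) := by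
        rw [measure_iUnion hdisj fun k => measurable_shift k (hA.inter (hmeas k))]
        exact tsum_congr fun k => (measurePreserving_shift p m hm k).measure_preimage
          (hA.inter (hmeas k)).nullMeasurableSet
    _ = Measure.sum (fun k => (stationaryLaw p m hm).restrict {ω | k ∈ sources i τ ω}) A := by
        simp only [Measure.sum_apply _ hA, Measure.restrict_apply hA]

omit hτ

theorem smul_mixLaw (ν : PMF S) :
    m i • mixLaw p m hm ν = (stationaryLaw p m hm).withDensity fun ω => demand m i ν (ω 0) := by
  have hdemand (x : S) : demand m i ν x * m x = m i * ν x :=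
    ENNReal.div_mul_cancel (hm.coe_ne_zero x) ENNReal.coe_ne_top
  rw [stationaryLaw, ← mixLaw_mul]
  simp_rw [hdemand]
  ext A hA
  rw [Measure.smul_apply, mixLaw_apply p m hm _ hA, mixLaw_apply p m hm _ hA, ENNReal.smul_def,
    smul_eq_mul, ← ENNReal.tsum_mul_left]
  simp_rw [mul_assoc]

include hτ in
theorem map_jump_eq_mixLaw_iff (ν : PMF S) :
    ((∀ᵐ ω ∂pathLaw p m hm i, τ ω ≠ ⊤) ∧ (pathLaw p m hm i).map (jump τ) = mixLaw p m hm ν) ↔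
      intake i τ =ᵐ[stationaryLaw p m hm] fun ω => demand m i ν (ω 0) := by
  have hdemand : Measurable fun ω : ℤ → S => demand m i ν (ω 0) :=
    (measurable_of_countable (demand m i ν)).comp (measurable_pi_apply 0)
  rw [← withDensity_eq_iff_of_sigmaFinite (measurable_intake i hτ).aemeasurable
    hdemand.aemeasurable, ← mass_transport i hτ, ← smul_mixLaw,
    (IsUnit.mk0 _ (hm.1 i).ne').smul_left_cancel]
  have hrestrict (hfin : ∀ᵐ ω ∂pathLaw p m hm i, τ ω ≠ ⊤) :
      (pathLaw p m hm i).restrict {ω | τ ω ≠ ⊤} = pathLaw p m hm i :=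
    Measure.restrict_eq_self_of_ae_mem hfin
  refine ⟨fun ⟨hfin, hmap⟩ => by rwa [hrestrict hfin], fun h => ?_⟩
  have hfin : ∀ᵐ ω ∂pathLaw p m hm i, τ ω ≠ ⊤ := by
    have hmeas : MeasurableSet {ω | τ ω ≠ ⊤} := (hτ (.singleton ⊤)).compl
    refine (mem_ae_iff_prob_eq_one hmeas).2 ?_
    rw [← Measure.restrict_apply_univ, ← Set.preimage_univ (f := jump τ),
      ← Measure.map_apply (measurable_jump hτ) .univ, h, measure_univ]
  exact ⟨hfin, by rwa [hrestrict hfin] at h⟩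

theorem exists_nat_demand_eq_of_ae_eq (ν : PMF S)
    (h : intake i τ =ᵐ[stationaryLaw p m hm] fun ω => demand m i ν (ω 0)) (j : S) :
    ∃ k : ℕ, demand m i ν j = k := by
  obtain ⟨ω, hω, hωj⟩ :=
    (((ae_stationaryLaw_iff p m hm).1 h j).and (pathLaw_ae_zero p m hm j)).exists
  have hintake : intake i τ ω = demand m i ν j := hω.trans (congrArg (demand m i ν) hωj)
  have hfin : demand m i ν j ≠ ∞ := demand_ne_top hm i ν j
  rw [← hintake, intake] at hfin ⊢
  obtain ⟨k, hk⟩ := ENat.ne_top_iff_exists.1 (ENat.toENNReal_ne_top.1 hfin)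
  exact ⟨k, by rw [← hk, ENat.toENNReal_coe]⟩

end MassTransport

section RecordTimes

/-- The times `n + 1 ≥ 1`, shifted by one, at which `u` exceeds all its earlier values but not the
level `c`. -/
def recordTimes (u : ℕ → ℤ) (c : ℤ) : Set ℕ := {n | (∀ j ≤ n, u j < u (n + 1)) ∧ u (n + 1) ≤ c}

variable {u : ℕ → ℤ} {c : ℤ}

theorem encard_recordTimes_le : (recordTimes u c).encard ≤ (Set.Ioc (u 0) c).encard := by
  refine Set.encard_le_encard_of_injOn (f := fun n => u (n + 1))
    (fun n hn => ⟨hn.1 0 n.zero_le, hn.2⟩) ?_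
  have hlt : ∀ n ∈ recordTimes u c, ∀ j < n, u (j + 1) < u (n + 1) := fun n hn j hj => hn.1 _ hj
  exact StrictMonoOn.injOn fun j _ n hn hj => hlt n hn j hj

theorem encard_recordTimes (hstep : ∀ n, u (n + 1) ≤ u n + 1) (hc : ∃ n, c ≤ u n) :
    (recordTimes u c).encard = (Set.Ioc (u 0) c).encard := by
  classical
  refine encard_recordTimes_le.antisymm ((Set.encard_le_encard fun b hb => ?_).trans
    (Set.encard_image_le (fun n => u (n + 1)) (recordTimes u c)))
  -- As the steps of `u` are at most one, `u` equals `b` when it first reaches the level `b`.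
  have hreach : ∃ n, b ≤ u n := hc.imp fun n hn => hb.2.trans hn
  have hbefore (j : ℕ) (hj : j < Nat.find hreach) : u j < b := not_le.1 (Nat.find_min hreach hj)
  obtain ⟨n, hn⟩ : ∃ n, Nat.find hreach = n + 1 := by
    refine Nat.exists_eq_succ_of_ne_zero fun h0 => ?_
    exact hb.1.not_ge (h0 ▸ Nat.find_spec hreach)
  have hub : u (n + 1) = b := by
    refine le_antisymm ?_ (hn ▸ Nat.find_spec hreach)
    exact (hstep n).trans (hbefore n (by lia))
  exact ⟨n, ⟨fun j hj => hub ▸ hbefore j (by lia), hub.trans_le hb.2⟩, hub⟩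

theorem encard_Ioc_neg_zero (k : ℕ) : (Set.Ioc (-k : ℤ) 0).encard = k := by
  rw [← Finset.coe_Ioc, Set.encard_coe_eq_coe_finsetCard, Int.card_Ioc]
  simp

end RecordTimes

section FirstTime

open scoped Classical in
/-- The first `n` with `P n`, and `⊤` if there is none, in the codomain of random times. -/
def firstTime (P : ℕ → Prop) : WithTop ℤ :=
  if h : ∃ n, P n then ((Nat.find h : ℤ) : WithTop ℤ) else ⊤

variable {P : ℕ → Prop}

theorem firstTime_nonneg : 0 ≤ firstTime P := by
  rw [firstTime]
  split_ifs with h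
  · exact WithTop.coe_le_coe.2 (Int.natCast_nonneg _)
  · exact le_top

theorem firstTime_eq_top_iff : firstTime P = ⊤ ↔ ∀ n, ¬ P n := by
  simp [firstTime]

open scoped Classical in
theorem firstTime_le_coe_iff {a : ℤ} : firstTime P ≤ a ↔ ∃ n : ℕ, n ≤ a ∧ P n := by
  rw [firstTime]
  split_ifs with h
  · rw [WithTop.coe_le_coe]
    refine ⟨fun ha => ⟨_, ha, Nat.find_spec h⟩, fun ⟨n, hn, hPn⟩ => ?_⟩
    exact (Int.ofNat_le.2 (Nat.find_min' h hPn)).trans hn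
  · simpa using fun n _ hPn => h ⟨n, hPn⟩

open scoped Classical in
theorem firstTime_eq_coe_iff {a : ℤ} :
    firstTime P = a ↔ ∃ n : ℕ, n = a ∧ P n ∧ ∀ l < n, ¬ P l := by
  rw [firstTime]
  split_ifs with h
  · rw [WithTop.coe_inj]
    refine ⟨fun ha => ⟨_, ha, Nat.find_spec h, fun _ => Nat.find_min h⟩, fun ⟨n, hn, hP⟩ => ?_⟩
    rw [(Nat.find_eq_iff _).2 hP, hn]
  · simpa using fun n _ hPn => (h ⟨n, hPn⟩).elim

end FirstTime

section Matching

variable (i : S) (k : S → ℕ)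

open scoped Classical in
/-- The net supply at a visit to `x`: a visit to `i` supplies one unit, a visit to `x` demands `k x`
units. -/
def charge (x : S) : ℤ := (if x = i then 1 else 0) - k x

/-- The net supply at the times `0, …, n - 1`. -/
def balance (f : ℕ → S) (n : ℕ) : ℤ := ∑ l ∈ Finset.range n, charge i k (f l)

/-- The first time at which the supply from time `0` on is used up. If demands are served by the
most recent supply left, this is the time at which a unit supplied at time `0` is used. -/
def matchTime (ω : ℤ → S) : WithTop ℤ := firstTime fun n => balance i k (future ω) (n + 1) ≤ 0

/-- For `n ≥ 1` the net supply at the first `n` times of the past `f`, read backwards from time `0`.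
The value at `0` is that of the demand at time `0` alone, so that the levels between the values at
`0` and `n` are the units demanded at time `0` which the supply at these times can serve. -/
def pastBalance (f : ℕ → S) : ℕ → ℤ
  | 0 => -k (f 0)
  | n + 1 => balance i k f (n + 1)

theorem charge_le_one (x : S) : charge i k x ≤ 1 := by
  unfold charge
  split_ifs <;> lia

theorem balance_succ (f : ℕ → S) (n : ℕ) :
    balance i k f (n + 1) = balance i k f n + charge i k (f n) :=
  Finset.sum_range_succ _ n

theorem balance_one (f : ℕ → S) : balance i k f 1 = charge i k (f 0) :=
  Finset.sum_range_one _

open scoped Classical in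
theorem pastBalance_one (f : ℕ → S) :
    pastBalance i k f 1 = pastBalance i k f 0 + if f 0 = i then 1 else 0 := by
  rw [pastBalance, pastBalance, balance_one, charge, sub_eq_neg_add]

theorem pastBalance_succ_le (f : ℕ → S) (n : ℕ) :
    pastBalance i k f (n + 1) ≤ pastBalance i k f n + 1 := by
  cases n with
  | zero =>
    rw [pastBalance_one]
    split_ifs <;> lia
  | succ n =>
    rw [pastBalance, balance_succ]
    exact add_le_add_right (charge_le_one i k _) _

theorem eq_of_pastBalance_lt {f : ℕ → S} {n : ℕ}
    (h : pastBalance i k f n < pastBalance i k f (n + 1)) : f n = i := by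
  by_contra hn
  cases n with
  | zero => simp [pastBalance_one, hn] at h
  | succ n =>
    simp only [pastBalance, balance_succ _ _ _ (n + 1), charge, if_neg hn] at h
    lia

theorem mem_recordTimes_pastBalance_iff {f : ℕ → S} {n : ℕ} {c : ℤ} :
    n ∈ recordTimes (pastBalance i k f) c ↔ f n = i ∧ balance i k f (n + 1) ≤ c ∧
      ∀ j < n, balance i k f (j + 1) < balance i k f (n + 1) := by
  refine ⟨fun ⟨hlt, hle⟩ => ⟨eq_of_pastBalance_lt i k (hlt n le_rfl), hle, fun j hj => hlt _ hj⟩,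
    fun ⟨hn, hle, hlt⟩ => ⟨fun j hj => ?_, hle⟩⟩
  cases j with
  | succ j => exact hlt j hj
  | zero =>
    have hone := pastBalance_one i k f
    cases n with
    | zero => simp [hone, hn]
    | succ n =>
      have hzero : pastBalance i k f 0 ≤ pastBalance i k f 1 := by
        rw [hone]
        split_ifs <;> lia
      exact hzero.trans_lt (hlt 0 n.succ_pos)

theorem balance_future_shift (ω : ℤ → S) (j n : ℕ) :
    balance i k (future (shift (-(j + n : ℕ)) ω)) (n + 1) =
      balance i k (past ω) (j + n + 1) - balance i k (past ω) j := by
  have hsplit : balance i k (past ω) (j + n + 1) = balance i k (past ω) j +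
      ∑ l ∈ Finset.range (n + 1), charge i k (past ω (j + l)) :=
    Finset.sum_range_add _ j (n + 1)
  rw [hsplit, add_sub_cancel_left, ← Finset.sum_range_reflect]
  refine Finset.sum_congr rfl fun l hl => congrArg (charge i k) (congrArg ω ?_)
  have := Finset.mem_range.1 hl
  lia

theorem balance_future_shift_neg (ω : ℤ → S) (n : ℕ) :
    balance i k (future (shift (-n) ω)) (n + 1) = balance i k (past ω) (n + 1) := by
  simpa [balance] using balance_future_shift i k ω 0 n

theorem sources_matchTime (ω : ℤ → S) :
    sources i (matchTime i k) ω = Nat.cast '' recordTimes (pastBalance i k (past ω)) 0 := by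
  ext a
  have hbefore (n : ℕ) : (∀ l < n, ¬ balance i k (future (shift (-n) ω)) (l + 1) ≤ 0) ↔
      ∀ j < n, balance i k (past ω) (j + 1) < balance i k (past ω) (n + 1) := by
    have hdiff (l j : ℕ) (hlj : j + 1 + l = n) : balance i k (future (shift (-n) ω)) (l + 1) =
        balance i k (past ω) (n + 1) - balance i k (past ω) (j + 1) :=
      hlj ▸ balance_future_shift i k ω (j + 1) l
    refine ⟨fun h j hj => ?_, fun h l hl => ?_⟩
    · have := h (n - (j + 1)) (by lia)
      rwa [hdiff _ j (by lia), not_le, sub_pos] at this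
    · rw [hdiff l (n - (l + 1)) (by lia), not_le, sub_pos]
      exact h _ (by lia)
  simp only [sources, matchTime, firstTime_eq_coe_iff, Set.mem_ofPred_eq, Set.mem_image,
    mem_recordTimes_pastBalance_iff]
  refine ⟨?_, ?_⟩
  · rintro ⟨hi, n, rfl, hle, hlt⟩
    exact ⟨n, ⟨hi, balance_future_shift_neg i k ω n ▸ hle, (hbefore n).1 hlt⟩, rfl⟩
  · rintro ⟨n, ⟨hi, hle, hlt⟩, rfl⟩
    exact ⟨hi, n, rfl, (balance_future_shift_neg i k ω n).symm ▸ hle, (hbefore n).2 hlt⟩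

theorem intake_matchTime (ω : ℤ → S) :
    intake i (matchTime i k) ω = (recordTimes (pastBalance i k (past ω)) 0).encard := by
  rw [intake, sources_matchTime, Nat.cast_injective.encard_image]

theorem intake_matchTime_le (ω : ℤ → S) : intake i (matchTime i k) ω ≤ k (ω 0) := by
  rw [intake_matchTime, ← ENat.toENNReal_coe, ENat.toENNReal_le, ← encard_Ioc_neg_zero]
  exact encard_recordTimes_le

theorem intake_matchTime_eq {ω : ℤ → S} (h : ∃ n, 0 ≤ balance i k (past ω) (n + 1)) :
    intake i (matchTime i k) ω = k (ω 0) := by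
  rw [intake_matchTime, ← ENat.toENNReal_coe, ENat.toENNReal_inj, ← encard_Ioc_neg_zero]
  obtain ⟨n, hn⟩ := h
  exact encard_recordTimes (pastBalance_succ_le i k _) ⟨n + 1, hn⟩

end Matching

section Dichotomy

theorem iterate_tail_future (n : ℕ) (ω : ℤ → S) : tail^[n] (future ω) = future (shift n ω) := by
  induction n with
  | zero => rw [iterate_zero_apply, Nat.cast_zero, shift_zero, id_eq]
  | succ n ih =>
    rw [iterate_succ_apply', ih]
    funext l
    exact congrArg ω (by lia)

variable [Countable S] [MeasurableSpace S] [MeasurableSingletonClass S]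
  {p : S → PMF S} {m : S → ℝ≥0}

theorem chainLaw_eq_zero_or_forall_chainLaw_dualPMF_eq_zero (hm : IsStationary p m)
    (hirr : IsIrreducible p) (hrec : IsRecurrent p) {F G : Set (ℕ → S)} (hF : MeasurableSet F)
    (hG : MeasurableSet G) (hFG : ∀ ω (t : ℕ), future ω ∈ G → past (shift t ω) ∉ F) (i : S) :
    chainLaw p i G = 0 ∨ ∀ j, chainLaw (dualPMF p m hm) j F = 0 := by
  refine or_iff_not_imp_left.2 fun hGi j => ?_
  obtain ⟨n, hn⟩ := hirr j i
  let G' : Set (ℕ → S) := {f | f n = i ∧ tail^[n] f ∈ G}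
  have hG' : MeasurableSet G' :=
    (measurableSet_apply_eq n i).inter ((measurable_tail.iterate n) hG)
  have hFG' : MeasurableSet {ω : ℤ → S | past ω ∈ F ∧ future ω ∈ G'} :=
    (measurable_past hF).inter (measurable_future hG')
  let E : Set (ℤ → S) := {ω | ω 0 = j ∧ past ω ∈ F ∧ future ω ∈ G'}
  have hE : MeasurableSet E := (measurableSet_apply_eq 0 j).inter hFG'
  -- Once `G'` holds, `F` fails from time `n` on, so that `E` does not recur.
  have hnever (ω : ℤ → S) (hω : ω ∈ E) : ¬ ∃ᶠ t in atTop, (shift 1)^[t] ω ∈ E := by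
    have hGω : future (shift n ω) ∈ G := iterate_tail_future n ω ▸ hω.2.2.2
    refine not_frequently.2 (eventually_atTop.2 ⟨n, fun t ht htE => ?_⟩)
    refine hFG (shift n ω) (t - n) hGω ?_
    rw [shift_shift, Nat.cast_sub ht, sub_add_cancel, ← iterate_shift_one]
    exact htE.2.1
  have hzero : stationaryLaw p m hm E = 0 := by
    refine measure_eq_zero_iff_ae_notMem.2 ?_
    filter_upwards [(conservative_shift_one p m hm hrec).ae_mem_imp_frequently_image_mem
      hE.nullMeasurableSet] with ω hω hωE using hnever ω hωE (hω hωE)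
  have hprod : stationaryLaw p m hm E =
      m j * (chainLaw (dualPMF p m hm) j F * (stepDist p n j i * chainLaw p i G)) := by
    rw [← chainLaw_inter_tail_iterate p n j i hG, ← pathLaw_past_future p m hm j hF hG']
    exact mixLaw_initial_and p m hm _ j hFG'
  simpa [hprod, (hm.1 j).ne', hn.ne', hGi] using hzero

end Dichotomy

section Matching

variable [Countable S] [MeasurableSpace S] [MeasurableSingletonClass S] (i : S) (k : S → ℕ)

@[fun_prop]
theorem measurable_balance (n : ℕ) : Measurable fun f : ℕ → S => balance i k f n :=
  Finset.measurable_fun_sum _ fun l _ =>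
    (measurable_of_countable (charge i k)).comp (measurable_pi_apply l)

theorem measurable_matchTime : Measurable (matchTime (S := S) i k) := by
  refine measurable_of_Iic fun a => ?_
  cases a with
  | top => simp only [Set.Iic_top, Set.preimage_univ, MeasurableSet.univ]
  | coe a =>
    have hpre : matchTime i k ⁻¹' Set.Iic (a : WithTop ℤ) =
        ⋃ n : ℕ, ⋃ _ : (n : ℤ) ≤ a, {ω | balance i k (future ω) (n + 1) ≤ 0} := by
      ext ω
      simp [matchTime, firstTime_le_coe_iff]
    rw [hpre]
    exact .iUnion fun n => .iUnion fun _ => measurableSet_le (by fun_prop) measurable_const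

theorem isStoppingTime_matchTime {Ω : Type*} [MeasurableSpace Ω] (X : ℤ → Ω → S)
    (hX : ∀ n, Measurable (X n)) :
    IsStoppingTime (forwardFiltration X hX) fun ω => matchTime i k fun n => X n ω := by
  intro a
  have hset : {ω | (matchTime i k fun n => X n ω) ≤ a} =
      ⋃ n : ℕ, ⋃ _ : (n : ℤ) ≤ a, {ω | ∑ l ∈ Finset.range (n + 1), charge i k (X l ω) ≤ 0} := by
    ext ω
    simp [matchTime, firstTime_le_coe_iff, balance, future]
  rw [hset]
  refine .iUnion fun n => .iUnion fun hn => ?_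
  refine measurableSet_le (Finset.measurable_fun_sum _ fun l hl => ?_) measurable_const
  refine (measurable_of_countable (charge i k)).comp ?_
  have hla : (l : ℤ) ∈ Set.Icc (0 : ℤ) a := by
    have := Finset.mem_range.1 hl
    exact ⟨by lia, by lia⟩
  have hle : MeasurableSpace.comap (X l) inferInstance ≤ forwardFiltration X hX a :=
    le_iSup₂_of_le (f := fun (n : ℤ) (_ : n ∈ Set.Icc (0 : ℤ) a) =>
      MeasurableSpace.comap (X n) inferInstance) (l : ℤ) hla le_rfl
  exact (comap_measurable (X l)).mono hle le_rfl

variable {p : S → PMF S} {m : S → ℝ≥0} (hm : IsStationary p m)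

theorem ae_matchTime_ne_top_or_ae_exists_balance_nonneg (hirr : IsIrreducible p)
    (hrec : IsRecurrent p) :
    (∀ᵐ ω ∂pathLaw p m hm i, matchTime i k ω ≠ ⊤) ∨
      ∀ᵐ ω ∂stationaryLaw p m hm, ∃ n, 0 ≤ balance i k (past ω) (n + 1) := by
  have hG : MeasurableSet {f : ℕ → S | ∀ n, 0 < balance i k f (n + 1)} := by
    simp only [Set.ofPred_forall]
    exact .iInter fun n => measurableSet_lt measurable_const (measurable_balance i k _)
  have hF : MeasurableSet {f : ℕ → S | ∀ n, balance i k f (n + 1) < 0} := by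
    simp only [Set.ofPred_forall]
    exact .iInter fun n => measurableSet_lt (measurable_balance i k _) measurable_const
  have hFG (ω : ℤ → S) (t : ℕ) (hω : ∀ n, 0 < balance i k (future ω) (n + 1)) :
      ¬ ∀ n, balance i k (past (shift t ω)) (n + 1) < 0 := fun h => by
    have hbalance := balance_future_shift_neg i k (shift t ω) t
    rw [shift_shift, neg_add_cancel, shift_zero, id_eq] at hbalance
    exact (hω t).not_gt (hbalance ▸ h t)
  refine (chainLaw_eq_zero_or_forall_chainLaw_dualPMF_eq_zero hm hirr hrec hF hG hFG i).imp
    (fun h => ?_) fun h => (ae_stationaryLaw_iff p m hm).2 fun j => ?_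
  · filter_upwards [(measurePreserving_future p m hm i).quasiMeasurePreserving.ae
      (measure_eq_zero_iff_ae_notMem.1 h)] with ω hω htop
    exact hω fun n => not_le.1 (firstTime_eq_top_iff.1 htop n)
  · filter_upwards [(measurePreserving_past p m hm j).quasiMeasurePreserving.ae
      (measure_eq_zero_iff_ae_notMem.1 (h j))] with ω hω
    by_contra! hneg
    exact hω hneg

theorem intake_matchTime_ae_eq (hirr : IsIrreducible p) (hrec : IsRecurrent p) {ν : PMF S}
    (hk : ∀ x, demand m i ν x = k x) :
    intake i (matchTime i k) =ᵐ[stationaryLaw p m hm] fun ω => demand m i ν (ω 0) := by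
  have hτ := measurable_matchTime i k
  have hdemand : Measurable fun ω : ℤ → S => demand m i ν (ω 0) :=
    (measurable_of_countable (demand m i ν)).comp (measurable_pi_apply 0)
  rcases ae_matchTime_ne_top_or_ae_exists_balance_nonneg i k hm hirr hrec with hfin | hserved
  · have hintake : ∫⁻ ω, intake i (matchTime i k) ω ∂stationaryLaw p m hm = m i := by
      have hrestrict : (pathLaw p m hm i).restrict {ω | matchTime i k ω ≠ ⊤} = pathLaw p m hm i :=
        Measure.restrict_eq_self_of_ae_mem hfin
      rw [← setLIntegral_univ, ← withDensity_apply _ .univ, ← mass_transport i hτ, hrestrict,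
        Measure.smul_apply, Measure.map_apply (measurable_jump hτ) .univ, Set.preimage_univ,
        measure_univ, ENNReal.smul_def, smul_eq_mul, mul_one]
    have hlintegral : ∫⁻ ω, demand m i ν (ω 0) ∂stationaryLaw p m hm = m i := by
      rw [← setLIntegral_univ, ← withDensity_apply _ .univ, ← smul_mixLaw, Measure.smul_apply,
        measure_univ, ENNReal.smul_def, smul_eq_mul, mul_one]
    refine ae_eq_of_ae_le_of_lintegral_le (.of_forall fun ω => ?_)
      (hintake.trans_ne ENNReal.coe_ne_top) hdemand.aemeasurable (hlintegral.trans hintake.symm).le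
    exact (intake_matchTime_le i k ω).trans_eq (hk _).symm
  · filter_upwards [hserved] with ω hω
    rw [intake_matchTime_eq i k hω, hk]

end Matching

section Embedding

theorem exists_int_iff_exists_nat_demand {p : S → PMF S} {m : S → ℝ≥0} (hm : IsStationary p m)
    (i j : S) (ν : PMF S) :
    (∃ k : ℤ, (m i : ℝ) / m j * (ν j).toReal = k) ↔ ∃ k : ℕ, demand m i ν j = k := by
  have hfin : demand m i ν j ≠ ∞ := demand_ne_top hm i ν j
  have hreal : (m i : ℝ) / m j * (ν j).toReal = (demand m i ν j).toReal := by
    rw [demand, ENNReal.toReal_div, ENNReal.toReal_mul, div_mul_eq_mul_div]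
    rfl
  rw [hreal]
  refine ⟨fun ⟨k, hk⟩ => ?_, fun ⟨k, hk⟩ => ⟨k, by simp [hk]⟩⟩
  have hnonneg : 0 ≤ k := Int.cast_nonneg_iff.1 (hk ▸ ENNReal.toReal_nonneg)
  lift k to ℕ using hnonneg
  exact ⟨k, (ENNReal.toReal_eq_toReal_iff' hfin (ENNReal.natCast_ne_top k)).1 (by simp [hk])⟩

variable [Countable S] [MeasurableSpace S] [MeasurableSingletonClass S]
  {p : S → PMF S} {m : S → ℝ≥0} (hm : IsStationary p m)
  {Ω : Type*} [MeasurableSpace Ω] {P : Measure Ω} {X : ℤ → Ω → S}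

theorem isTwoSidedChain_iff (hX : ∀ n, Measurable (X n)) (ν : PMF S) :
    IsTwoSidedChain p m ν P X ↔ P.map (fun ω n => X n ω) = mixLaw p m hm ν := by
  have hpath : Measurable fun ω n => X n ω := measurable_pi_lambda _ hX
  have hblock (a b : ℕ) (x : ℤ → S) :
      P {ω | ∀ k : ℤ, -(a : ℤ) ≤ k → k ≤ (b : ℤ) → X k ω = x k} =
        P.map (fun ω n => X n ω) {ω | ∀ k ∈ Finset.Icc (-a : ℤ) b, ω k = x k} := by
    rw [Measure.map_apply hpath (measurableSet_forall_mem_eq _ _)]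
    simp only [Finset.mem_Icc, and_imp, Set.preimage_ofPred_eq]
  refine ⟨fun h => (ext_of_forall_Icc (fun z => measure_ne_top _ _) fun a b x => ?_).symm,
    fun h => ⟨hX, fun a b x => ?_⟩⟩
  · rw [mixLaw_block, ← hblock, h.prob_block]
  · rw [hblock, h, mixLaw_block]

variable {i : S} (hX : IsTwoSidedChain p m (PMF.pure i) P X)

include hm hX

theorem isEmbedding_iff {τ : (ℤ → S) → WithTop ℤ} (hτ : Measurable τ) (ν : PMF S) :
    IsEmbedding p m ν P X (fun ω => τ fun n => X n ω) ↔
      intake i τ =ᵐ[stationaryLaw p m hm] fun ω => demand m i ν (ω 0) := by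
  have hpath : Measurable fun ω n => X n ω := measurable_pi_lambda _ hX.measurable
  have hlaw : P.map (fun ω n => X n ω) = pathLaw p m hm i := by
    rw [(isTwoSidedChain_iff hm hX.measurable _).1 hX, mixLaw_pure]
  have hshifted (n : ℤ) : Measurable (shifted X (fun ω => τ fun n => X n ω) n) :=
    (measurable_pi_apply n).comp ((measurable_jump hτ).comp hpath)
  have htop : MeasurableSet {ω | τ ω ≠ ⊤} := (hτ (.singleton ⊤)).compl
  rw [← map_jump_eq_mixLaw_iff i hτ, ← hlaw, IsEmbedding, isTwoSidedChain_iff hm hshifted,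
    ae_map_iff hpath.aemeasurable htop, Measure.map_map (measurable_jump hτ) hpath]
  rfl

theorem exists_nat_demand_eq_of_isEmbedding {T : Ω → WithTop ℤ} (hT : NonRandomized X T)
    {ν : PMF S} (hE : IsEmbedding p m ν P X T) (j : S) : ∃ k : ℕ, demand m i ν j = k := by
  obtain ⟨τ, hτ, hTτ⟩ := hT
  obtain rfl : T = fun ω => τ fun n => X n ω := funext hTτ
  exact exists_nat_demand_eq_of_ae_eq i p m hm ν ((isEmbedding_iff hm hX hτ ν).1 hE) j

theorem exists_isEmbedding_isStoppingTime (hirr : IsIrreducible p) (hrec : IsRecurrent p)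
    {ν : PMF S} (h : ∀ j, ∃ k : ℕ, demand m i ν j = k) :
    ∃ T : Ω → WithTop ℤ, NonRandomized X T ∧ IsEmbedding p m ν P X T ∧ (∀ ω, 0 ≤ T ω) ∧
      IsStoppingTime (forwardFiltration X hX.measurable) T := by
  choose k hk using h
  have hτ := measurable_matchTime i k
  exact ⟨fun ω => matchTime i k fun n => X n ω, ⟨_, hτ, fun _ => rfl⟩,
    (isEmbedding_iff hm hX hτ ν).2 (intake_matchTime_ae_eq i k hm hirr hrec hk),
    fun _ => firstTime_nonneg, isStoppingTime_matchTime i k X hX.measurable⟩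

end Embedding

end TwoSided

end

theorem theorem1 {S : Type*} [Countable S] [MeasurableSpace S] [MeasurableSingletonClass S]
    (p : S → PMF S) (hirr : TwoSided.IsIrreducible p) (hrec : TwoSided.IsRecurrent p)
    (m : S → ℝ≥0) (hm : TwoSided.IsStationary p m)
    {Ω : Type*} [MeasurableSpace Ω] (P : Measure Ω) [IsProbabilityMeasure P]
    (X : ℤ → Ω → S) (i : S) (hX : TwoSided.IsTwoSidedChain p m (PMF.pure i) P X)
    (ν : PMF S) :
    ((∃ T : Ω → WithTop ℤ, TwoSided.NonRandomized X T ∧ TwoSided.IsEmbedding p m ν P X T) ↔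
      ∀ j : S, ∃ k : ℤ, (m i : ℝ) / (m j : ℝ) * (ν j).toReal = (k : ℝ)) ∧
    ((∃ T : Ω → WithTop ℤ, TwoSided.NonRandomized X T ∧ TwoSided.IsEmbedding p m ν P X T) →
      ∃ T : Ω → WithTop ℤ, TwoSided.NonRandomized X T ∧ TwoSided.IsEmbedding p m ν P X T ∧
        (∀ ω, 0 ≤ T ω) ∧
        IsStoppingTime (TwoSided.forwardFiltration X hX.measurable) T) := by
  simp only [TwoSided.exists_int_iff_exists_nat_demand hm]
  have necessity : (∃ T : Ω → WithTop ℤ, TwoSided.NonRandomized X T ∧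
      TwoSided.IsEmbedding p m ν P X T) → ∀ j, ∃ k : ℕ, TwoSided.demand m i ν j = k :=
    fun ⟨_, hT, hE⟩ => TwoSided.exists_nat_demand_eq_of_isEmbedding hm hX hT hE
  have sufficiency := TwoSided.exists_isEmbedding_isStoppingTime hm hX hirr hrec (ν := ν)
  refine ⟨⟨necessity, fun h => ?_⟩, fun h => sufficiency (necessity h)⟩
  obtain ⟨T, hT, hE, -⟩ := sufficiency h
  exact ⟨T, hT, hE⟩
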